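/- Let $n\ge 1$ be an integer and let $D\subseteq\{d : d\mid n,\ 1\le d<n\}$. The integral circulant graph $\mathrm{ICG}_n(D)$ has vertex set $\mathbb{Z}_n=\{0,1,\dots,n-1\}$, and $a,b\in\mathbb{Z}_n$ are adjacent if and only if $\gcd(a-b,n)\in D$. For a graph $G$ with adjacency matrix $A_G$ put $F(t)=\exp(\mathrm{i}tA_G)$; there is perfect state transfer (PST) between distinct vertices $a$ and $b$ of $G$ if $|F(t)_{ab}|=1$ for some real $t>0$, and $G$ has PST if this happens for some pair of distinct vertices. The perfect quantum communication distance of a pair of vertices between which PST exists is their distance in $G$. Theorem. Suppose that $\mathrm{ICG}_n(D)$ has PST. Then $n$ is even, and exactly one of the following holds: $n/2\in D$; or $4\mid n$ and $n/4\in D$. Moreover, for $a,b\in\mathbb{Z}_n$, PST exists between $a$ and $b$ if and only if $b=a+n/2$ in $\mathbb{Z}_n$, and for every $b\in\mathbb{Z}_n$ the perfect quantum communication distance of $b$ and $b+n/2$ equals $1$ if $n/2\in D$, and equals $2$ otherwise. (In particular, apart from this alternative, the distance does not depend on $n$.) -/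

import Mathlib

/-- The integral circulant graph `ICG_n(D)`: the vertex set is `ℤ/nℤ = {0, 1, …, n - 1}`, and two
(distinct) vertices `a`, `b` are adjacent iff `gcd (a - b, n) ∈ D`. When every element of `D` is a
divisor of `n` smaller than `n`, the requirement `a ≠ b` is automatic. -/
def ICG (n : ℕ) (D : Finset ℕ) : SimpleGraph (ZMod n) where
  Adj a b := a ≠ b ∧ Int.gcd ((a.val : ℤ) - (b.val : ℤ)) (n : ℤ) ∈ D
  symm := ⟨fun a b h => ⟨h.1.symm, by
    have h2 := h.2
    rwa [← neg_sub, Int.neg_gcd] at h2⟩⟩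
  loopless := ⟨fun _ h => h.1 rfl⟩

instance ICG.instDecidableRelAdj (n : ℕ) (D : Finset ℕ) : DecidableRel (ICG n D).Adj :=
  fun a b => inferInstanceAs
    (Decidable (a ≠ b ∧ Int.gcd ((a.val : ℤ) - (b.val : ℤ)) (n : ℤ) ∈ D))

section PST

variable {V : Type*} [Fintype V] [DecidableEq V]

/-- The time evolution operator `F(t) = exp(i t A_G)`, where `A_G` is the adjacency matrix. -/
noncomputable def evolution (G : SimpleGraph V) [DecidableRel G.Adj] (t : ℝ) : Matrix V V ℂ :=
  NormedSpace.exp ((Complex.I * (t : ℂ)) • G.adjMatrix ℂ)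

/-- There is perfect state transfer in `G` between the distinct vertices `a` and `b`. -/
def PSTBetween (G : SimpleGraph V) [DecidableRel G.Adj] (a b : V) : Prop :=
  a ≠ b ∧ ∃ t : ℝ, 0 < t ∧ ‖evolution G t a b‖ = 1

/-- There is perfect state transfer in `G`. -/
def HasPST (G : SimpleGraph V) [DecidableRel G.Adj] : Prop :=
  ∃ a b : V, PSTBetween G a b

/-- The perfect quantum communication distance of the pair `a`, `b` is `k`: perfect state transfer
exists between `a` and `b`, and their graph distance is `k`. -/
def IsPQCD (G : SimpleGraph V) [DecidableRel G.Adj] (a b : V) (k : ℕ) : Prop :=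
  PSTBetween G a b ∧ G.Reachable a b ∧ G.dist a b = k

end PST

open Finset

/-! The characters of `ZMod n` diagonalise the graph. If PST occurs at time t from a to b, unitarity
leaves one nonzero entry u in row a of F(t), so exp(itλ_j) = u·χ(j(b - a)) for every j. Since λ_j =
λ_{-j}, this forces b - a = n/2, and the phases become u(-1)^j. Write n = m·2^e with m odd. Summing
λ over the class of j modulo 2^e leaves m times a character sum over the subgroup killed by 2^e
(`sum_eigenvalue`); as m is odd, the sums for j = 1 and j = 2 must differ (`sum_eigenvalue_one_ne`).
Pairing elements with their translates (`two_mul_sum_kernel`) evaluates the character sums, for e ≥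
2, as -[n/2 ∈ D] and [n/2 ∈ D] - 2[n/4 ∈ D], which differ exactly when one of n/2, n/4 is in D. -/

open scoped Matrix.Norms.Operator in
theorem SemiconjBy.matrix_exp {V : Type*} [Fintype V] [DecidableEq V] {P A B : Matrix V V ℂ}
    (h : SemiconjBy P A B) : SemiconjBy P (NormedSpace.exp A) (NormedSpace.exp B) :=
  h.exp_right

/-! ### Diagonalisation by characters -/

/-- The indicator function of the connection set of `ICG n D`. -/
noncomputable def ICG.connection (n : ℕ) (D : Finset ℕ) (x : ZMod n) : ℂ :=
  if Nat.gcd x.val n ∈ D then 1 else 0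

/-- The eigenvalue of `ICG n D` belonging to the character `x ↦ e (j * x)` of `ZMod n`. -/
noncomputable def ICG.eigenvalue (n : ℕ) [NeZero n] (D : Finset ℕ) (j : ZMod n) : ℂ :=
  ∑ x : ZMod n, connection n D x * ZMod.stdAddChar (j * x)

namespace ICG

variable {n : ℕ} [NeZero n] {D : Finset ℕ}

theorem int_gcd_val_sub_val (a b : ZMod n) :
    Int.gcd ((a.val : ℤ) - (b.val : ℤ)) (n : ℤ) = Nat.gcd (a - b).val n := by
  have h : ((a - b).val : ℤ) = ((a.val : ℤ) - b.val) % n := by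
    rw [← ZMod.val_intCast]; simp
  rw [← Int.gcd_natCast_natCast, h, Int.gcd_emod]

theorem adj_iff (hD : D ⊆ n.properDivisors) {a b : ZMod n} :
    (ICG n D).Adj a b ↔ Nat.gcd (a - b).val n ∈ D := by
  change (a ≠ b ∧ _) ↔ _
  rw [int_gcd_val_sub_val]
  refine and_iff_right_of_imp fun h => ?_
  rintro rfl
  simpa using hD h

theorem gcd_val_neg (x : ZMod n) : Nat.gcd (-x).val n = Nat.gcd x.val n := by
  have h := int_gcd_val_sub_val x 0
  have h' := int_gcd_val_sub_val 0 x
  rw [sub_zero] at h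
  rw [zero_sub] at h'
  rw [← h, ← h', ← neg_sub, Int.neg_gcd]

theorem connection_neg (x : ZMod n) : connection n D (-x) = connection n D x := by
  rw [connection, gcd_val_neg, connection]

theorem gcd_val_natCast (n k : ℕ) : Nat.gcd ((k : ZMod n)).val n = Nat.gcd k n := by
  rw [ZMod.val_natCast, ← Nat.gcd_rec, Nat.gcd_comm]

theorem eigenvalue_neg (j : ZMod n) : eigenvalue n D (-j) = eigenvalue n D j := by
  unfold eigenvalue
  refine Fintype.sum_equiv (Equiv.neg _) _ _ fun x => ?_
  simp [connection_neg]

theorem stdAddChar_ne_zero (x : ZMod n) : (ZMod.stdAddChar x : ℂ) ≠ 0 := by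
  rw [ZMod.stdAddChar_apply]; exact Circle.coe_ne_zero _

/-- The characters of `ZMod n` as the columns of a matrix. -/
noncomputable def characterMatrix (n : ℕ) [NeZero n] : Matrix (ZMod n) (ZMod n) ℂ :=
  Matrix.of fun x j => ZMod.stdAddChar (j * x)

theorem adjMatrix_mul_characterMatrix (hD : D ⊆ n.properDivisors) :
    (ICG n D).adjMatrix ℂ * characterMatrix n =
      characterMatrix n * Matrix.diagonal (eigenvalue n D) := by
  ext a j
  rw [Matrix.mul_diagonal, Matrix.mul_apply, eigenvalue, Finset.mul_sum]
  refine Fintype.sum_equiv (Equiv.subRight a) _ _ fun x => ?_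
  simp only [SimpleGraph.adjMatrix_apply, adj_iff hD, characterMatrix, Matrix.of_apply,
    Equiv.subRight_apply]
  rw [← connection_neg, neg_sub, connection]
  split_ifs
  · rw [one_mul, one_mul, ← AddChar.map_add_eq_mul, ← mul_add, add_sub_cancel]
  · simp

theorem evolution_mul_characterMatrix (hD : D ⊆ n.properDivisors) (t : ℝ) :
    evolution (ICG n D) t * characterMatrix n = characterMatrix n *
      Matrix.diagonal fun j => Complex.exp (Complex.I * t * eigenvalue n D j) := by
  have h : SemiconjBy (characterMatrix n)
      ((Complex.I * (t : ℂ)) • Matrix.diagonal (eigenvalue n D))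
      ((Complex.I * (t : ℂ)) • (ICG n D).adjMatrix ℂ) := by
    rw [SemiconjBy, Matrix.mul_smul, Matrix.smul_mul, adjMatrix_mul_characterMatrix hD]
  have h2 := (SemiconjBy.matrix_exp h).eq
  rw [← Matrix.diagonal_smul, Matrix.exp_diagonal, Pi.exp_def] at h2
  rw [evolution, ← h2, Complex.exp_eq_exp_ℂ]
  simp only [Pi.smul_apply, smul_eq_mul]

/-- Translations are automorphisms, so their permutation matrices commute with the adjacency matrix
and its exponential. -/
theorem evolution_add_right (hD : D ⊆ n.properDivisors) (t : ℝ) (a b c : ZMod n) :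
    evolution (ICG n D) t (a + c) (b + c) = evolution (ICG n D) t a b := by
  have h : SemiconjBy ((Equiv.addRight c).permMatrix ℂ)
      ((Complex.I * (t : ℂ)) • (ICG n D).adjMatrix ℂ)
      ((Complex.I * (t : ℂ)) • (ICG n D).adjMatrix ℂ) := by
    rw [SemiconjBy, PEquiv.toMatrix_toPEquiv_mul, PEquiv.mul_toMatrix_toPEquiv]
    ext x y
    simp [SimpleGraph.adjMatrix_apply, adj_iff hD, sub_eq_add_neg, add_assoc]
  have h2 := congrFun (congrFun (SemiconjBy.matrix_exp h).eq a) (b + c)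
  rw [PEquiv.toMatrix_toPEquiv_mul, PEquiv.mul_toMatrix_toPEquiv] at h2
  simpa [evolution] using h2

end ICG

/-! ### Unitarity and the position of the PST partner -/

section Unitary

variable {V : Type*} [Fintype V] [DecidableEq V] (G : SimpleGraph V) [DecidableRel G.Adj]

theorem evolution_mul_conjTranspose (t : ℝ) :
    evolution G t * (evolution G t).conjTranspose = 1 := by
  rw [evolution, ← Matrix.exp_conjTranspose, Matrix.conjTranspose_smul,
    (show (G.adjMatrix ℂ).conjTranspose = G.adjMatrix ℂ by
      ext i j; simp [SimpleGraph.adjMatrix_apply, apply_ite, G.adj_comm])]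
  have : star (Complex.I * (t : ℂ)) = -(Complex.I * t) := by simp
  have hc : Commute ((Complex.I * (t : ℂ)) • G.adjMatrix ℂ)
      (-((Complex.I * (t : ℂ)) • G.adjMatrix ℂ)) := (Commute.refl _).neg_right
  rw [this, neg_smul, ← Matrix.exp_add_of_commute _ _ hc,
    add_neg_cancel, NormedSpace.exp_zero]

theorem sum_norm_sq_evolution (t : ℝ) (a : V) : ∑ x, ‖evolution G t a x‖ ^ 2 = 1 := by
  have h := congrFun (congrFun (evolution_mul_conjTranspose G t) a) a
  rw [Matrix.mul_apply, Matrix.one_apply_eq] at h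
  simp only [Matrix.conjTranspose_apply, Complex.star_def, Complex.mul_conj'] at h
  exact_mod_cast h

theorem evolution_eq_zero_of_norm_eq_one {t : ℝ} {a b : V} (h : ‖evolution G t a b‖ = 1)
    {x : V} (hx : x ≠ b) : evolution G t a x = 0 := by
  have h1 := sum_norm_sq_evolution G t a
  rw [← Finset.add_sum_erase _ _ (Finset.mem_univ b), h, one_pow, add_eq_left,
    Finset.sum_eq_zero_iff_of_nonneg fun _ _ => sq_nonneg _] at h1
  simpa using h1 x (Finset.mem_erase.2 ⟨hx, Finset.mem_univ _⟩)

end Unitary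

namespace ICG

variable {n : ℕ} [NeZero n] {D : Finset ℕ}

theorem exp_eigenvalue_of_norm_evolution_eq_one (hD : D ⊆ n.properDivisors) {t : ℝ}
    {a b : ZMod n} (h : ‖evolution (ICG n D) t a b‖ = 1) (j : ZMod n) :
    Complex.exp (Complex.I * t * eigenvalue n D j) =
      evolution (ICG n D) t a b * ZMod.stdAddChar (j * (b - a)) := by
  have h1 := congrFun (congrFun (evolution_mul_characterMatrix hD t) a) j
  rw [Matrix.mul_diagonal, Matrix.mul_apply, Finset.sum_eq_single b
    (fun x _ hx => by rw [evolution_eq_zero_of_norm_eq_one _ h hx, zero_mul])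
    (fun hb => absurd (Finset.mem_univ b) hb)] at h1
  simp only [characterMatrix, Matrix.of_apply] at h1
  rw [mul_sub, AddChar.map_sub_eq_div, ← mul_div_assoc, h1,
    mul_div_cancel_left₀ _ (stdAddChar_ne_zero _)]

/-- Evenness of the spectrum at j = ±1 and injectivity of the standard character give b - a = -(b -
a). -/
theorem sub_eq_half_of_pstBetween (hD : D ⊆ n.properDivisors) {a b : ZMod n}
    (h : PSTBetween (ICG n D) a b) : 2 ∣ n ∧ b - a = ((n / 2 : ℕ) : ZMod n) := by
  obtain ⟨hab, t, -, ht⟩ := h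
  have hu : evolution (ICG n D) t a b ≠ 0 := by
    intro h0; simp [h0] at ht
  have h1 := exp_eigenvalue_of_norm_evolution_eq_one hD ht 1
  have h2 := exp_eigenvalue_of_norm_evolution_eq_one hD ht (-1)
  rw [eigenvalue_neg, h1] at h2
  have h3 := ZMod.injective_stdAddChar (mul_left_cancel₀ hu h2)
  rw [one_mul, neg_one_mul, eq_comm, ZMod.neg_eq_self_iff] at h3
  have h4 := h3.resolve_left (sub_ne_zero.2 hab.symm)
  refine ⟨⟨_, h4.symm⟩, ?_⟩
  rw [← ZMod.natCast_zmod_val (b - a)]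
  congr 1; omega

end ICG

/-! ### Character sums over the 2-primary subgroup -/

theorem Nat.gcd_add_two_pow {a k y : ℕ} (h : ¬ 2 ^ k ∣ y) :
    Nat.gcd (y + 2 ^ k) (2 ^ a) = Nat.gcd y (2 ^ a) := by
  -- Divisors of 2^a are totally ordered, so one dividing a number that 2^k does not divide must
  -- divide 2^k.
  have key : ∀ d u, ¬ 2 ^ k ∣ u → d ∣ u → d ∣ 2 ^ a → d ∣ 2 ^ k := by
    intro d u hu hdu hda
    obtain ⟨i, -, rfl⟩ := (Nat.dvd_prime_pow Nat.prime_two).1 hda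
    refine pow_dvd_pow 2 (le_of_not_ge fun hki => hu ((pow_dvd_pow 2 hki).trans hdu))
  refine Nat.dvd_antisymm (Nat.dvd_gcd ?_ (Nat.gcd_dvd_right _ _))
    (Nat.dvd_gcd ?_ (Nat.gcd_dvd_right _ _))
  · refine (Nat.dvd_add_iff_left (key _ (y + 2 ^ k) ?_ (Nat.gcd_dvd_left _ _)
      (Nat.gcd_dvd_right _ _))).2 (Nat.gcd_dvd_left _ _)
    rwa [Nat.dvd_add_self_right]
  · exact dvd_add (Nat.gcd_dvd_left _ _) (key _ y h (Nat.gcd_dvd_left _ _) (Nat.gcd_dvd_right _ _))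

theorem Nat.gcd_add_two_pow_mul {a k m v : ℕ} (hm : m ∣ v) (h : ¬ m * 2 ^ k ∣ v) :
    Nat.gcd (v + m * 2 ^ k) (m * 2 ^ a) = Nat.gcd v (m * 2 ^ a) := by
  obtain ⟨y, rfl⟩ := hm
  rw [← mul_add, Nat.gcd_mul_left, Nat.gcd_mul_left, Nat.gcd_add_two_pow]
  exact fun hy => h (mul_dvd_mul_left m hy)

namespace ICG

variable {n : ℕ} [NeZero n] {D : Finset ℕ}

theorem dvd_val_of_mul_eq_zero {M m : ℕ} (hn : n = m * M) {x : ZMod n} (hx : (M : ZMod n) * x = 0) :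
    m ∣ x.val := by
  have hM : 0 < M := Nat.pos_of_ne_zero fun h => NeZero.ne n (by rw [hn, h, mul_zero])
  rw [← ZMod.natCast_zmod_val x, ← Nat.cast_mul, ZMod.natCast_eq_zero_iff, mul_comm] at hx
  refine Nat.dvd_of_mul_dvd_mul_right hM ?_
  rwa [← hn]

theorem connection_add {a k m : ℕ} (hn : n = m * 2 ^ a) {x : ZMod n}
    (hx : ((2 ^ a : ℕ) : ZMod n) * x = 0) (h : ¬ m * 2 ^ k ∣ x.val) :
    connection n D (x + (m * 2 ^ k : ℕ)) = connection n D x := by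
  have h1 := Nat.gcd_add_two_pow_mul (a := a) (dvd_val_of_mul_eq_zero hn hx) h
  rw [← hn, ← gcd_val_natCast, Nat.cast_add, ZMod.natCast_zmod_val] at h1
  rw [connection, h1, connection]

/-- For fixed x the sum over k is geometric with ratio χ(Mx), an m-th root of unity: it vanishes
unless Mx = 0. -/
theorem sum_eigenvalue {M m : ℕ} (hn : n = m * M) (j : ZMod n) :
    ∑ k ∈ range m, eigenvalue n D (j + M * k) =
      m * ∑ x : ZMod n with (M : ZMod n) * x = 0, connection n D x * ZMod.stdAddChar (j * x) := by
  simp only [eigenvalue]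
  rw [sum_comm, mul_sum, sum_filter]
  refine sum_congr rfl fun x _ => ?_
  have h : ∀ k : ℕ, (ZMod.stdAddChar ((j + (M : ZMod n) * (k : ZMod n)) * x) : ℂ) =
      ZMod.stdAddChar (j * x) * ZMod.stdAddChar ((M : ZMod n) * x) ^ k := by
    intro k
    rw [← AddChar.map_nsmul_eq_pow, ← AddChar.map_add_eq_mul]
    congr 1
    rw [nsmul_eq_mul]; ring
  simp only [h, ← mul_sum, ← mul_assoc]
  split_ifs with hx
  · rw [hx]; simp; ring
  · have h1 : (ZMod.stdAddChar ((M : ZMod n) * x) : ℂ) ≠ 1 := by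
      rwa [← AddChar.map_zero_eq_one (ZMod.stdAddChar (N := n)), ZMod.injective_stdAddChar.ne_iff]
    rw [geom_sum_eq h1, ← AddChar.map_nsmul_eq_pow, nsmul_eq_mul, ← mul_assoc, ← Nat.cast_mul, ← hn]
    simp

/-- Translation by q preserves the subgroup and flips the sign of the character. Adding the sum to
its translate cancels all terms outside the multiples of q. Used with q = n/2, j = 1 and q = n/4, j
= 2. -/
theorem two_mul_sum_kernel {M c q : ℕ} (hn : n = c * q) {j : ZMod n}
    (hj : (ZMod.stdAddChar (j * (q : ZMod n)) : ℂ) = -1) (hq : (M : ZMod n) * q = 0)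
    (hinv : ∀ x : ZMod n, (M : ZMod n) * x = 0 → ¬ q ∣ x.val →
      connection n D (x + q) = connection n D x) :
    2 * ∑ x : ZMod n with (M : ZMod n) * x = 0, connection n D x * ZMod.stdAddChar (j * x) =
      ∑ i ∈ range c, (connection n D (i * q : ℕ) - connection n D ((i + 1) * q : ℕ)) *
        (-1) ^ i := by
  have hq0 : 0 < q := Nat.pos_of_ne_zero fun h => NeZero.ne n (by rw [hn, h, mul_zero])
  have h1 : ∑ x : ZMod n with (M : ZMod n) * x = 0, connection n D x * ZMod.stdAddChar (j * x) =
      ∑ x : ZMod n with (M : ZMod n) * x = 0,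
        -(connection n D (x + q) * ZMod.stdAddChar (j * x)) := by
    refine (Finset.sum_equiv (Equiv.addRight (q : ZMod n)) ?_ ?_).symm
    · intro x
      simp [mul_add, hq]
    · intro x _
      simp only [Equiv.coe_addRight]
      rw [mul_add j, AddChar.map_add_eq_mul, hj]; ring
  rw [two_mul]
  nth_rewrite 2 [h1]
  rw [← sum_add_distrib]
  have hval : ∀ i ∈ range c, ((i * q : ℕ) : ZMod n).val = i * q := by
    intro i hi
    refine ZMod.val_cast_of_lt ?_
    rw [hn]
    exact Nat.mul_lt_mul_of_pos_right (mem_range.1 hi) hq0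
  have hinj : Set.InjOn (fun i : ℕ => ((i * q : ℕ) : ZMod n)) (range c) := by
    intro i hi i' hi' h
    have h2 := congrArg ZMod.val h
    simp only at h2
    rw [hval i hi, hval i' hi'] at h2
    exact Nat.eq_of_mul_eq_mul_right hq0 h2
  have hsub : (range c).image (fun i : ℕ => ((i * q : ℕ) : ZMod n)) ⊆
      ({x | (M : ZMod n) * x = 0} : Finset (ZMod n)) := by
    intro x hx
    obtain ⟨i, -, rfl⟩ := mem_image.1 hx
    rw [mem_filter_univ, Nat.cast_mul, mul_left_comm, hq, mul_zero]
  rw [← sum_subset hsub, sum_image hinj]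
  · refine sum_congr rfl fun i _ => ?_
    have h2 : (ZMod.stdAddChar (j * ((i * q : ℕ) : ZMod n)) : ℂ) = (-1) ^ i := by
      rw [← hj, ← AddChar.map_nsmul_eq_pow, nsmul_eq_mul]
      congr 1; push_cast; ring
    rw [h2, add_mul i 1 q, one_mul, Nat.cast_add]; ring
  · intro x hx hx'
    rw [mem_filter_univ] at hx
    rw [hinv x hx, add_neg_cancel]
    rintro ⟨i, hi⟩
    refine hx' (mem_image.2 ⟨i, mem_range.2 ?_, ?_⟩)
    · have : i * q < c * q := by rw [← hn, mul_comm, ← hi]; exact x.val_lt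
      exact lt_of_mul_lt_mul_right this (Nat.zero_le q)
    · rw [mul_comm, ← hi, ZMod.natCast_zmod_val]

omit [NeZero n] in
theorem connection_natCast (k : ℕ) :
    connection n D (k : ZMod n) = if Nat.gcd k n ∈ D then 1 else 0 := by
  rw [connection, gcd_val_natCast]

omit [NeZero n] in
theorem connection_natCast_self (hD : D ⊆ n.properDivisors) : connection n D (n : ℕ) = 0 := by
  rw [connection_natCast, Nat.gcd_self, if_neg fun h => by simpa using hD h]

theorem stdAddChar_half (h2 : 2 ∣ n) : (ZMod.stdAddChar ((n / 2 : ℕ) : ZMod n) : ℂ) = -1 := by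
  have h := NeZero.pos n
  have hne : (ZMod.stdAddChar ((n / 2 : ℕ) : ZMod n) : ℂ) ≠ 1 := by
    rw [← AddChar.map_zero_eq_one (ZMod.stdAddChar (N := n)), ZMod.injective_stdAddChar.ne_iff, Ne,
      ZMod.natCast_eq_zero_iff]
    exact fun hd => by have := Nat.le_of_dvd (by omega) hd; omega
  refine (sq_eq_one_iff.1 ?_).resolve_left hne
  rw [← AddChar.map_nsmul_eq_pow, nsmul_eq_mul, ← Nat.cast_mul, Nat.mul_div_cancel' h2,
    ZMod.natCast_self, AddChar.map_zero_eq_one]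

theorem sum_kernel_one (hD : D ⊆ n.properDivisors) {a m : ℕ} (hn : n = m * 2 ^ (a + 1)) :
    ∑ x : ZMod n with ((2 ^ (a + 1) : ℕ) : ZMod n) * x = 0,
      connection n D x * ZMod.stdAddChar (1 * x) = -if n / 2 ∈ D then 1 else 0 := by
  have hn' : n = 2 * (m * 2 ^ a) := by rw [hn]; ring
  have hh : n / 2 = m * 2 ^ a := by omega
  have h := two_mul_sum_kernel (D := D) (M := 2 ^ (a + 1)) hn' (j := 1)
    (by rw [one_mul, ← hh, stdAddChar_half ⟨_, hn'⟩])
    (by rw [← Nat.cast_mul, ZMod.natCast_eq_zero_iff, hn]; exact ⟨2 ^ a, by ring⟩)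
    (fun x hx hd => connection_add hn hx hd)
  rw [← hh] at h hn'
  have h0 : connection n D ((0 : ℕ) : ZMod n) = 0 := by
    rw [← connection_natCast_self hD, ZMod.natCast_self, Nat.cast_zero]
  simp only [sum_range_succ, sum_range_zero, zero_mul, zero_add, one_mul, one_add_one_eq_two,
    ← hn', connection_natCast_self hD, h0, pow_zero, pow_one] at h
  rw [connection_natCast, Nat.gcd_eq_left ⟨2, by omega⟩] at h
  simp only [one_mul]
  linear_combination h / 2

theorem sum_kernel_two (hD : D ⊆ n.properDivisors) {a m : ℕ} (hn : n = m * 2 ^ (a + 2)) :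
    ∑ x : ZMod n with ((2 ^ (a + 2) : ℕ) : ZMod n) * x = 0,
      connection n D x * ZMod.stdAddChar (2 * x) =
        (if n / 2 ∈ D then 1 else 0) - 2 * if n / 4 ∈ D then 1 else 0 := by
  have hn' : n = 4 * (m * 2 ^ a) := by rw [hn]; ring
  have hq : n / 4 = m * 2 ^ a := by omega
  have hh : n / 2 = 2 * (m * 2 ^ a) := by omega
  have h := two_mul_sum_kernel (D := D) (M := 2 ^ (a + 2)) hn' (j := 2)
    (by rw [← Nat.cast_ofNat, ← Nat.cast_mul, ← hh, stdAddChar_half ⟨2 * (m * 2 ^ a), by omega⟩])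
    (by rw [← Nat.cast_mul, ZMod.natCast_eq_zero_iff, hn]; exact ⟨2 ^ a, by ring⟩)
    (fun x hx hd => connection_add hn hx hd)
  have h0 : connection n D 0 = 0 := by
    rw [← connection_natCast_self hD, ZMod.natCast_self]
  have h1 : connection n D ((m * 2 ^ a : ℕ) : ZMod n) = if n / 4 ∈ D then 1 else 0 := by
    rw [connection_natCast, Nat.gcd_eq_left ⟨4, by omega⟩, hq]
  have h2 : connection n D ((2 * (m * 2 ^ a) : ℕ) : ZMod n) = if n / 2 ∈ D then 1 else 0 := by
    rw [connection_natCast, Nat.gcd_eq_left ⟨2, by omega⟩, hh]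
  -- Modulo n, three quarters is minus one quarter.
  have h3 : connection n D ((3 * (m * 2 ^ a) : ℕ) : ZMod n) = if n / 4 ∈ D then 1 else 0 := by
    rw [← h1, ← connection_neg]
    congr 1
    rw [neg_eq_iff_add_eq_zero, ← Nat.cast_add, ZMod.natCast_eq_zero_iff]
    exact ⟨1, by omega⟩
  have h4 : connection n D ((4 * (m * 2 ^ a) : ℕ) : ZMod n) = 0 := by
    rw [← hn', connection_natCast_self hD]
  norm_num only [sum_range_succ, sum_range_zero, zero_mul, zero_add, one_mul, Nat.cast_zero, h0, h1, h2, h3, h4]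
    at h
  linear_combination h / 2

/-- Covers e = 1, where n/4 is unavailable: the subgroup is {0, n/2}. -/
theorem sum_kernel_two_of_half_notMem (hD : D ⊆ n.properDivisors) (h2 : 2 ∣ n) (h : n / 2 ∉ D) :
    ∑ x : ZMod n with ((2 : ℕ) : ZMod n) * x = 0,
      connection n D x * ZMod.stdAddChar (2 * x) = 0 := by
  refine sum_eq_zero fun x hx => ?_
  rw [mem_filter_univ, Nat.cast_ofNat, two_mul, add_eq_zero_iff_neg_eq, ZMod.neg_eq_self_iff] at hx
  rw [connection, if_neg, zero_mul]
  rcases hx with rfl | hx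
  · rw [ZMod.val_zero, Nat.gcd_zero_left]
    exact fun h => by simpa using hD h
  · rw [Nat.gcd_eq_left ⟨2, by omega⟩]
    rwa [show x.val = n / 2 by omega]

/-! ### The dichotomy and the distance -/

theorem exp_sum_eigenvalue (hD : D ⊆ n.properDivisors) {t : ℝ} {a b : ZMod n}
    (h : ‖evolution (ICG n D) t a b‖ = 1) (h2 : 2 ∣ n) (hab : b - a = ((n / 2 : ℕ) : ZMod n))
    {M m : ℕ} (hM : 2 ∣ M) (j : ℕ) :
    Complex.exp (Complex.I * t * ∑ k ∈ range m, eigenvalue n D (j + M * k)) =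
      evolution (ICG n D) t a b ^ m * ((-1) ^ j) ^ m := by
  rw [mul_sum, Complex.exp_sum, ← mul_pow]
  refine (prod_congr rfl fun k _ => ?_).trans ((prod_const _).trans (by rw [card_range]))
  rw [exp_eigenvalue_of_norm_evolution_eq_one hD h, hab]
  congr 1
  obtain ⟨c, rfl⟩ := hM
  have hj : ((j : ZMod n) + (2 * c : ℕ) * k) * ((n / 2 : ℕ) : ZMod n) =
      (j + 2 * (c * k)) • ((n / 2 : ℕ) : ZMod n) := by
    rw [nsmul_eq_mul]; push_cast; ring
  rw [hj, AddChar.map_nsmul_eq_pow, stdAddChar_half h2, pow_add, pow_mul]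
  simp

/-- Equal sums would give -u^m = u^m, since m is odd; but |u| = 1. -/
theorem sum_eigenvalue_one_ne (hD : D ⊆ n.properDivisors) {t : ℝ} {a b : ZMod n}
    (h : ‖evolution (ICG n D) t a b‖ = 1) (h2 : 2 ∣ n) (hab : b - a = ((n / 2 : ℕ) : ZMod n))
    {M m : ℕ} (hM : 2 ∣ M) (hm : Odd m) :
    ∑ k ∈ range m, eigenvalue n D (1 + M * k) ≠ ∑ k ∈ range m, eigenvalue n D (2 + M * k) := by
  intro he
  have h3 := exp_sum_eigenvalue (m := m) hD h h2 hab hM 1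
  have h4 := exp_sum_eigenvalue (m := m) hD h h2 hab hM 2
  rw [Nat.cast_one, he] at h3
  rw [Nat.cast_two, h3, pow_one, hm.neg_one_pow, neg_one_sq, one_pow] at h4
  have h5 : evolution (ICG n D) t a b ^ m = 0 := by linear_combination -h4 / 2
  rw [pow_eq_zero_iff hm.pos.ne'] at h5
  simp [h5] at h

theorem xor_of_pstBetween (hD : D ⊆ n.properDivisors) {a b : ZMod n}
    (h : PSTBetween (ICG n D) a b) : Xor (n / 2 ∈ D) (4 ∣ n ∧ n / 4 ∈ D) := by
  obtain ⟨h2, hab⟩ := sub_eq_half_of_pstBetween hD h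
  obtain ⟨-, t, -, ht⟩ := h
  obtain ⟨e, m, hm, hn⟩ := Nat.exists_eq_two_pow_mul_odd (NeZero.ne n)
  rw [mul_comm] at hn
  rcases e with _ | _ | e
  · rw [pow_zero, mul_one] at hn
    rw [hn] at h2
    exact absurd h2 hm.not_two_dvd_nat
  · have h4 : ¬ 4 ∣ n := by
      obtain ⟨c, rfl⟩ := hm
      omega
    refine Or.inl ⟨?_, fun h => h4 h.1⟩
    by_contra hn2
    refine sum_eigenvalue_one_ne hD ht h2 hab (M := 2 ^ (0 + 1)) ⟨1, rfl⟩ hm ?_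
    rw [sum_eigenvalue hn, sum_eigenvalue hn, sum_kernel_one hD hn, if_neg hn2, neg_zero]
    have := sum_kernel_two_of_half_notMem hD h2 hn2
    rw [zero_add, pow_one, this]
  · have h4 : 4 ∣ n := ⟨m * 2 ^ e, by rw [hn]; ring⟩
    have hne := sum_eigenvalue_one_ne hD ht h2 hab (M := 2 ^ (e + 2)) ⟨2 ^ (e + 1), by ring⟩ hm
    rw [sum_eigenvalue hn, sum_eigenvalue hn, sum_kernel_one hD hn, sum_kernel_two hD hn] at hne
    -- The two sums agree when both memberships hold (-1 = 1 - 2) or neither does (0 = 0).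
    by_cases hd2 : n / 2 ∈ D <;> by_cases hd4 : n / 4 ∈ D
    · exact absurd (by norm_num [hd2, hd4]) hne
    · exact Or.inl ⟨hd2, fun h => hd4 h.2⟩
    · exact Or.inr ⟨⟨h4, hd4⟩, hd2⟩
    · exact absurd (by norm_num [hd2, hd4]) hne

theorem pstBetween_add_half (hD : D ⊆ n.properDivisors) (h : HasPST (ICG n D)) (b : ZMod n) :
    PSTBetween (ICG n D) b (b + ((n / 2 : ℕ) : ZMod n)) := by
  obtain ⟨u, v, huv⟩ := h
  obtain ⟨-, hs⟩ := sub_eq_half_of_pstBetween hD huv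
  obtain ⟨hne, t, ht0, ht⟩ := huv
  rw [← hs]
  refine ⟨by simpa [sub_eq_zero] using hne.symm, t, ht0, ?_⟩
  rw [← ht, ← evolution_add_right hD t u v (b - u)]
  congr 2 <;> ring

theorem adj_add_natCast (hD : D ⊆ n.properDivisors) {d : ℕ} (hd : d ∣ n) (b : ZMod n) :
    (ICG n D).Adj b (b + (d : ZMod n)) ↔ d ∈ D := by
  rw [SimpleGraph.adj_comm, adj_iff hD, add_sub_cancel_left, gcd_val_natCast, Nat.gcd_eq_left hd]

end ICG

theorem mainTheorem2 (n : ℕ) [NeZero n] (D : Finset ℕ) (hD : D ⊆ n.properDivisors)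
    (hPST : HasPST (ICG n D)) :
    2 ∣ n ∧
    Xor (n / 2 ∈ D) (4 ∣ n ∧ n / 4 ∈ D) ∧
    (∀ a b : ZMod n, PSTBetween (ICG n D) a b ↔ b = a + ((n / 2 : ℕ) : ZMod n)) ∧
    (∀ b : ZMod n, IsPQCD (ICG n D) b (b + ((n / 2 : ℕ) : ZMod n))
      (if n / 2 ∈ D then 1 else 2)) := by
  obtain ⟨u, v, huv⟩ := id hPST
  have h2 := (ICG.sub_eq_half_of_pstBetween hD huv).1
  have hxor := ICG.xor_of_pstBetween hD huv
  refine ⟨h2, hxor, fun a b => ⟨fun h => ?_, ?_⟩, fun b => ?_⟩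
  · rw [← (ICG.sub_eq_half_of_pstBetween hD h).2, add_sub_cancel]
  · rintro rfl
    exact ICG.pstBetween_add_half hD hPST a
  have hpst := ICG.pstBetween_add_half hD hPST b
  refine ⟨hpst, ?_⟩
  have hadj := ICG.adj_add_natCast hD (Nat.div_dvd_of_dvd h2) b
  split_ifs with hd
  · have h1 := hadj.2 hd
    exact ⟨h1.reachable, SimpleGraph.dist_eq_one_iff_adj.2 h1⟩
  · obtain ⟨⟨h4, hd4⟩, -⟩ := hxor.resolve_left fun h => hd h.1
    have hadj4 := fun c => (ICG.adj_add_natCast hD (Nat.div_dvd_of_dvd h4) c).2 hd4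
    have hq : b + ((n / 4 : ℕ) : ZMod n) + ((n / 4 : ℕ) : ZMod n) = b + ((n / 2 : ℕ) : ZMod n) := by
      rw [add_assoc, ← Nat.cast_add, show n / 4 + n / 4 = n / 2 by omega]
    -- A path of length 2 through the midpoint b + n/4.
    let p := (hadj4 b).toWalk.append (hadj4 (b + ((n / 4 : ℕ) : ZMod n))).toWalk
    have hp : p.length = 2 := by simp [p]
    rw [← hq] at hpst hadj ⊢
    refine ⟨p.reachable, le_antisymm (hp ▸ SimpleGraph.dist_le p) ?_⟩
    have h0 := p.reachable.pos_dist_of_ne hpst.1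
    have h1 : (ICG n D).dist b (b + ((n / 4 : ℕ) : ZMod n) + ((n / 4 : ℕ) : ZMod n)) ≠ 1 :=
      fun h => hd (hadj.1 (SimpleGraph.dist_eq_one_iff_adj.1 h))
    omega
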